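/- **Theorem 1.** Let $n,p\ge 1$ be integers and $m=np$. Let $X_1,\dots,X_n$ and $Y_1,\dots,Y_m$ be independent real random variables, the $X_i$ with distribution function $F$ and the $Y_i$ with distribution function $G$, where $F=G$ is continuous. Let $F_n$ and $G_m$ be the empirical distribution functions of $X_1,\dots,X_n$ and $Y_1,\dots,Y_m$, let $Z_{(1)}\le\dots\le Z_{(n+m)}$ be the order statistics of the pooled sample, and put $$D_{nm}=\sup_{t\in\mathbb R}\{F_n(t)-G_m(t)\},\qquad R_{nm}=\min\{1\le i\le n+m: F_n(Z_{(i)})-G_m(Z_{(i)})=D_{nm}\},$$ $$T_{nm}=\frac{D_{nm}}{\sqrt{R_{nm}(n+m-R_{nm})}}\ \text{ if } R_{nm}\le n+m-1,\qquad T_{nm}=0\ \text{ if } R_{nm}=n+m .$$ For integers $1\le r\le n+m$ and $0\le k\le m$ let $s=(r+k)\frac{n}{n+m}$. Put $P_{nm}(r,k)=0$ unless $s$ is an integer with $s\le\min\{r,n\}$, and in that case put $$P_{nm}(r,k)=\frac{\binom{n+m-r+1}{n-s}}{\binom{n+m}{n}}\,\frac{k+1}{n+m-r+1}\sum_{j=0}^{[\frac{n}{n+m}k]}\frac{m/n}{r+k-1-j\frac{n+m}{n}}\binom{j\frac{n+m}{n}-k}{j}\binom{r+k-1-j\frac{n+m}{n}}{s-1-j},$$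 where $[\cdot]$ is the floor function and $\binom{a}{j}=a(a-1)\cdots(a-j+1)/j!$. Then: (i) $\mathbb P(R_{nm}=r,\ D_{nm}=k/m)=P_{nm}(r,k)$ for all $1\le r\le n+m$ and $0\le k\le m$. (ii) For every $x\ge 0$ the distribution function $J_{nm}$ of $T_{nm}$ satisfies $$J_{nm}(x)=\mathbb P(T_{nm}\le x)=\sum_{r=1}^{n+m-1}\ \sum_{k=0}^{\min\{[m\sqrt{r(n+m-r)}\,x],\,m\}}P_{nm}(r,k)+\frac{m}{(n+m)(n+m-1)} .$$ (iii) $J_{nm}(x)=0$ for every $x<0$. -/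

import Mathlib

open MeasureTheory ProbabilityTheory

/-- The empirical distribution function of a sample `x 0, …, x (n-1)`:
the proportion of the observations that are at most `t`. -/
noncomputable def empiricalDF {n : ℕ} (x : Fin n → ℝ) (t : ℝ) : ℝ :=
  ((Finset.univ.filter fun i => x i ≤ t).card : ℝ) / (n : ℝ)

/-- The one-sided Smirnov statistic `D = sup_t (F_n(t) - G_m(t))`
(a supremum over a nonempty bounded set of reals). -/
noncomputable def statD {n m : ℕ} (x : Fin n → ℝ) (y : Fin m → ℝ) : ℝ :=
  ⨆ t : ℝ, (empiricalDF x t - empiricalDF y t)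

/-- The order statistics of the pooled sample `x 0, …, x (n-1), y 0, …, y (m-1)`, in nondecreasing
order; the index is zero-based, so `orderStat x y j` is the `(j+1)`-st smallest observation. -/
noncomputable def orderStat {n m : ℕ} (x : Fin n → ℝ) (y : Fin m → ℝ) (j : Fin (n + m)) : ℝ :=
  Fin.append x y (Tuple.sort (Fin.append x y) j)

/-- The smallest (one-based) index `i` in `{1, …, n+m}` with
`F_n(Z_(i)) - G_m(Z_(i)) = D`, where `Z_(i)` are the pooled order statistics. -/
noncomputable def statR {n m : ℕ} (x : Fin n → ℝ) (y : Fin m → ℝ) : ℕ :=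
  sInf {i : ℕ | ∃ j : Fin (n + m), i = (j : ℕ) + 1 ∧
    empiricalDF x (orderStat x y j) - empiricalDF y (orderStat x y j) = statD x y}

/-- The statistic `T = D / √(R (n+m-R))` if `R ≠ n+m`, and `T = 0` if `R = n+m`. -/
noncomputable def statT {n m : ℕ} (x : Fin n → ℝ) (y : Fin m → ℝ) : ℝ :=
  if statR x y = n + m then 0
  else statD x y / Real.sqrt ((statR x y : ℝ) * ((n : ℝ) + (m : ℝ) - (statR x y : ℝ)))

/-- Gutjahr's explicit point probabilities `P_{nm}(r, k)`. With `s = (r+k) n / (n+m)`, the value is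
given by the formula if `s` is an integer and `s ≤ min r n`, and is `0` otherwise.
`Ring.choose a j = a (a-1) ⋯ (a-j+1) / j!` is the generalized binomial coefficient. The summation
index runs from `0` to the integer part of `n k / (n+m)`; for `r ≥ 1` this gives `j < s`, so the
subtraction in `s - 1 - j` is not truncated. -/
noncomputable def gutjahrProb (n m r k : ℕ) : ℝ :=
  let s : ℕ := (r + k) * n / (n + m)
  let c : ℝ := ((n : ℝ) + (m : ℝ)) / (n : ℝ)
  if (n + m) ∣ (r + k) * n ∧ s ≤ min r n then
    (Nat.choose (n + m - r + 1) (n - s) : ℝ) / (Nat.choose (n + m) n : ℝ)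
      * (((k : ℝ) + 1) / ((n : ℝ) + (m : ℝ) - (r : ℝ) + 1))
      * ∑ j ∈ Finset.range (n * k / (n + m) + 1),
          ((m : ℝ) / (n : ℝ)) / ((r : ℝ) + (k : ℝ) - 1 - (j : ℝ) * c)
            * Ring.choose ((j : ℝ) * c - (k : ℝ)) j
            * Ring.choose ((r : ℝ) + (k : ℝ) - 1 - (j : ℝ) * c) (s - 1 - j)
  else 0

/-! Read the pooled sample in increasing order as a word, `true` for an X and `false` for a Y. Since
m = np, the value of m(F_n - G_m) at the i-th order statistic is the height after i letters of a
walk with steps +p and -1 that ends at 0. So mD is the maximum height and R the first time in 1,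
..., n+m at which it is attained. Continuity excludes ties almost surely, all orderings of an i.i.d.
sample are equally likely, and each word with n letters `true` comes from equally many orderings; it
remains to count words (`measureReal_eq_card_div`, `card_permWord_div`).

Cutting a word at its first maximum, of height k at time r, factors the count
(`wordCount_isFirstMax`). The tail never exceeds its starting height and falls by k; the hitting
time theorem `succ_mul_nonposCount` counts it. The head reaches level k for the first time after
time 0 at time r. Conditioning on its first letter gives a recurrence in the level; its solution
`firstCount_eq_sum` expresses level k through level 0, where the hitting time theorem applies again
(`firstCount_zero_eq`). This is the sum over j in the formula. The law of T follows by summing the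
joint law of R and D; r = n+m supplies the extra term. -/

/-- The increment of the walk attached to a letter: `+p` for `true`, `-1` for `false`. -/
def walkStep (p : ℕ) (b : Bool) : ℤ := if b then (p : ℤ) else -1

/-- The position after `i` steps of the walk attached to the word `w`. -/
def height (p : ℕ) {N : ℕ} (w : Fin N → Bool) (i : ℕ) : ℤ :=
  ∑ j : Fin N, if (j : ℕ) < i then walkStep p (w j) else 0

lemma height_zero (p : ℕ) {N : ℕ} (w : Fin N → Bool) : height p w 0 = 0 := by
  simp [height]

lemma height_cons (p : ℕ) {N : ℕ} (b : Bool) (w : Fin N → Bool) (i : ℕ) :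
    height p (Fin.cons b w : Fin (N + 1) → Bool) (i + 1) = walkStep p b + height p w i := by
  simp [height, Fin.sum_univ_succ]

lemma height_snoc (p : ℕ) {N : ℕ} (w : Fin N → Bool) (b : Bool) {i : ℕ} (hi : i ≤ N) :
    height p (Fin.snoc w b : Fin (N + 1) → Bool) i = height p w i := by
  simp [height, Fin.sum_univ_castSucc, hi]

lemma height_snoc_last (p : ℕ) {N : ℕ} (w : Fin N → Bool) (b : Bool) :
    height p (Fin.snoc w b : Fin (N + 1) → Bool) (N + 1) = height p w N + walkStep p b := by
  simp only [height, Fin.sum_univ_castSucc, Fin.snoc_castSucc, Fin.snoc_last, Fin.val_castSucc,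
    Fin.val_last]
  congr 1
  · refine Finset.sum_congr rfl fun j _ => ?_
    rw [if_pos (by omega), if_pos j.isLt]
  · simp

lemma height_append_left (p : ℕ) {r q : ℕ} (u : Fin r → Bool) (v : Fin q → Bool) {i : ℕ}
    (hi : i ≤ r) : height p (Fin.append u v) i = height p u i := by
  simp only [height, Fin.sum_univ_add, Fin.append_left, Fin.append_right, Fin.val_castAdd,
    Fin.val_natAdd]
  rw [add_eq_left]
  exact Finset.sum_eq_zero fun j _ => if_neg (by omega)

lemma height_append_right (p : ℕ) {r q : ℕ} (u : Fin r → Bool) (v : Fin q → Bool) (i : ℕ) :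
    height p (Fin.append u v) (r + i) = height p u r + height p v i := by
  simp only [height, Fin.sum_univ_add, Fin.append_left, Fin.append_right, Fin.val_castAdd,
    Fin.val_natAdd, add_lt_add_iff_left]
  congr 1
  refine Finset.sum_congr rfl fun j _ => ?_
  rw [if_pos (by omega), if_pos j.isLt]

/-! ### Counting words by their first letter, last letter or a cut. -/

open Classical in
/-- The number of words of length `N` with the property `Q`. -/
noncomputable def wordCount {N : ℕ} (Q : (Fin N → Bool) → Prop) : ℕ :=
  (Finset.univ.filter Q).card

lemma wordCount_eq_card {N : ℕ} (Q : (Fin N → Bool) → Prop) [DecidablePred Q] :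
    wordCount Q = (Finset.univ.filter Q).card := by
  unfold wordCount
  congr

lemma wordCount_congr {N : ℕ} {Q Q' : (Fin N → Bool) → Prop} (h : ∀ w, Q w ↔ Q' w) :
    wordCount Q = wordCount Q' := by
  rw [funext fun w => propext (h w)]

lemma wordCount_eq_zero {N : ℕ} {Q : (Fin N → Bool) → Prop} (h : ∀ w, ¬ Q w) :
    wordCount Q = 0 := by
  simp [wordCount, h]

lemma wordCount_cons {N : ℕ} (Q : (Fin (N + 1) → Bool) → Prop) :
    wordCount Q = wordCount (fun w : Fin N → Bool => Q (Fin.cons true w)) +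
      wordCount (fun w : Fin N → Bool => Q (Fin.cons false w)) := by
  simp only [wordCount, Finset.card_filter]
  rw [← (Fin.consEquiv fun _ : Fin (N + 1) => Bool).sum_comp, Fintype.sum_prod_type]
  simp only [Fin.consEquiv, Fintype.sum_bool, Equiv.coe_fn_mk]
  rfl

lemma wordCount_snoc {N : ℕ} (Q : (Fin (N + 1) → Bool) → Prop) :
    wordCount Q = wordCount (fun w : Fin N → Bool => Q (Fin.snoc w true)) +
      wordCount (fun w : Fin N → Bool => Q (Fin.snoc w false)) := by
  simp only [wordCount, Finset.card_filter]
  rw [← (Fin.snocEquiv fun _ : Fin (N + 1) => Bool).sum_comp, Fintype.sum_prod_type]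
  simp only [Fin.snocEquiv, Fintype.sum_bool, Equiv.coe_fn_mk]
  rfl

lemma wordCount_append {r q : ℕ} (Q : (Fin (r + q) → Bool) → Prop)
    (A : (Fin r → Bool) → Prop) (B : (Fin q → Bool) → Prop)
    (h : ∀ u v, Q (Fin.append u v) ↔ A u ∧ B v) :
    wordCount Q = wordCount A * wordCount B := by
  unfold wordCount
  rw [← Finset.card_product]
  symm
  refine Finset.card_bij' (fun x _ => Fin.append x.1 x.2)
    (fun w _ => (fun i => w (Fin.castAdd q i), fun i => w (Fin.natAdd r i))) ?_ ?_ ?_ ?_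
  · simp [h]
  · intro w hw
    have := (h (fun i => w (Fin.castAdd q i)) (fun i => w (Fin.natAdd r i)))
    rw [Fin.append_castAdd_natAdd] at this
    simpa [this] using hw
  · simp
  · intro w _
    exact Fin.append_castAdd_natAdd

/-! ### Walks that stay nonpositive: the hitting time theorem. -/

/-- The number of words of length `q` whose walk never becomes positive and ends at `-k`. -/
noncomputable def nonposCount (p q k : ℕ) : ℕ :=
  wordCount fun v : Fin q → Bool => (∀ i ≤ q, height p v i ≤ 0) ∧ height p v q = -(k : ℤ)

lemma nonposCount_zero (p : ℕ) (k : ℕ) : nonposCount p 0 k = if k = 0 then 1 else 0 := by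
  unfold nonposCount
  simp only [Nat.le_zero, forall_eq, height_zero]
  split_ifs with h
  · simp [wordCount, h]
  · exact wordCount_eq_zero fun v h' => by omega

lemma forall_le_snoc_iff (p : ℕ) {q : ℕ} (v : Fin q → Bool) (b : Bool) (k : ℤ) (hk : k ≤ 0) :
    ((∀ i ≤ q + 1, height p (Fin.snoc v b : Fin (q + 1) → Bool) i ≤ 0) ∧
      height p (Fin.snoc v b : Fin (q + 1) → Bool) (q + 1) = k) ↔
    (∀ i ≤ q, height p v i ≤ 0) ∧ height p v q = k - walkStep p b := by
  rw [height_snoc_last]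
  constructor
  · rintro ⟨h1, h2⟩
    refine ⟨fun i hi => ?_, by omega⟩
    rw [← height_snoc p v b hi]
    exact h1 i (by omega)
  · rintro ⟨h1, h2⟩
    refine ⟨fun i hi => ?_, by omega⟩
    rcases Nat.lt_or_ge q i with h | h
    · obtain rfl : i = q + 1 := by omega
      rw [height_snoc_last]
      omega
    · rw [height_snoc p v b h]
      exact h1 i h

/-- The last step into 0 must be an up-step, because a down-step would start at the forbidden height
1. -/
lemma nonposCount_succ_zero (p q : ℕ) : nonposCount p (q + 1) 0 = nonposCount p q p := by
  unfold nonposCount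
  rw [wordCount_snoc]
  simp only [forall_le_snoc_iff p _ _ (-((0 : ℕ) : ℤ)) (by simp)]
  rw [wordCount_eq_zero (Q := fun v => _ ∧ height p v q = -((0 : ℕ) : ℤ) - walkStep p false),
    add_zero]
  · exact wordCount_congr fun v => by simp [walkStep]
  · rintro v ⟨h1, h2⟩
    have := h1 q le_rfl
    simp [walkStep] at h2
    omega

lemma nonposCount_succ_succ (p q k : ℕ) :
    nonposCount p (q + 1) (k + 1) = nonposCount p q (k + 1 + p) + nonposCount p q k := by
  unfold nonposCount
  rw [wordCount_snoc]
  simp only [forall_le_snoc_iff p _ _ (-((k + 1 : ℕ) : ℤ)) (by omega)]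
  simp only [walkStep, if_true, Bool.false_eq_true, if_false]
  congr 1 <;> refine wordCount_congr fun v => ?_ <;> push_cast <;> constructor <;>
    rintro ⟨h1, h2⟩ <;> exact ⟨h1, by linarith⟩

lemma nonposCount_eq_zero (p : ℕ) {q k : ℕ} (h : q < k) : nonposCount p q k = 0 := by
  induction q generalizing k with
  | zero => rw [nonposCount_zero, if_neg (by omega)]
  | succ q ih =>
    obtain ⟨k, rfl⟩ : ∃ l, k = l + 1 := ⟨k - 1, by omega⟩
    rw [nonposCount_succ_succ, ih (by omega), ih (by omega)]

/-- The hitting time theorem for walks with steps `+p` and `-1`. -/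
theorem succ_mul_nonposCount (p : ℕ) {q k u : ℕ} (h : q = k + (p + 1) * u) :
    (q + 1) * nonposCount p q k = (k + 1) * (q + 1).choose u := by
  induction q generalizing k u with
  | zero =>
    obtain rfl : k = 0 := by omega
    obtain rfl : u = 0 := by
      rcases Nat.eq_zero_or_pos u with h' | h'
      · exact h'
      · have := Nat.mul_pos (Nat.succ_pos p) h'
        simp at h; omega
    simp [nonposCount_zero]
  | succ q ih =>
    rcases k with _ | k
    · obtain ⟨u, rfl⟩ : ∃ l, u = l + 1 := by
        rcases u with _ | u
        · simp at h
        · exact ⟨u, rfl⟩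
      have hq : q = p + (p + 1) * u := by rw [mul_add] at h; omega
      have h1 := ih hq
      have h2 := Nat.add_one_mul_choose_eq (q + 1) u
      rw [nonposCount_succ_zero]
      apply Nat.eq_of_mul_eq_mul_left (Nat.succ_pos q)
      have h3 : q + 1 = (p + 1) * (u + 1) := by rw [hq]; ring
      calc (q + 1) * ((q + 1 + 1) * nonposCount p q p)
          = (q + 1 + 1) * ((q + 1) * nonposCount p q p) := by ring
        _ = (p + 1) * ((q + 1 + 1) * (q + 1).choose u) := by rw [h1]; ring
        _ = (p + 1) * (u + 1) * (q + 1 + 1).choose (u + 1) := by rw [h2]; ring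
        _ = _ := by rw [← h3]; simp
    · rw [nonposCount_succ_succ]
      rcases u with _ | u
      -- With u = 0 only the all-down word remains.
      · have hq : q = k := by simpa using h
        rw [nonposCount_eq_zero p (by omega)]
        have h2 : (q + 1) * nonposCount p q k = (k + 1) * (q + 1).choose 0 := ih (by simp [hq])
        have h3 : nonposCount p q k = 1 := by
          apply Nat.eq_of_mul_eq_mul_left (Nat.succ_pos q)
          rw [Nat.succ_eq_add_one, h2, hq]; simp
        rw [h3]; simp [hq]
      · have h1 := ih (k := k + 1 + p) (u := u) (by rw [mul_add] at h; omega)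
        have h2 := ih (k := k) (u := u + 1) (by omega)
        have hq : q = k + (p + 1) * (u + 1) := by omega
        have h3 := Nat.choose_succ_right_eq (q + 1) u
        have hle : u ≤ q + 1 := by nlinarith
        rw [Nat.choose_succ_succ (q + 1) u]
        zify [hle] at h1 h2 h3 hq ⊢
        have hpos : (0 : ℤ) < (q : ℤ) + 1 := by positivity
        apply mul_left_cancel₀ hpos.ne'
        set a : ℤ := ((q + 1).choose u : ℤ)
        set b : ℤ := ((q + 1).choose (u + 1) : ℤ)
        -- The induction hypotheses turn both counts into multiples of a and b; what remains follows
        -- from the ratio of consecutive binomials `h3`.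
        have hA : ((q : ℤ) + 2) * ((k + p + 2) * a + (k + 1) * b) =
            (q + 1) * (k + 2) * (a + b) := by
          rw [hq] at h3 ⊢
          linear_combination (-((p : ℤ) + 1)) * h3
        linear_combination ((q : ℤ) + 2) * h1 + ((q : ℤ) + 2) * h2 + hA

/-! ### First passage to a level. -/

/-- The number of words of length `r` whose walk, after time `0`, reaches level `d` or higher
for the first time at time `r`, and is exactly at level `d` then. -/
noncomputable def firstCount (p r : ℕ) (d : ℤ) : ℕ :=
  wordCount fun u : Fin r → Bool =>
    (∀ i, 1 ≤ i → i < r → height p u i < d) ∧ height p u r = d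

lemma first_cons_iff (p : ℕ) {r : ℕ} (hr : 1 ≤ r) (u : Fin r → Bool) (b : Bool) (d : ℤ) :
    ((∀ i, 1 ≤ i → i < r + 1 → height p (Fin.cons b u : Fin (r + 1) → Bool) i < d) ∧
      height p (Fin.cons b u : Fin (r + 1) → Bool) (r + 1) = d) ↔
    walkStep p b < d ∧ (∀ i, 1 ≤ i → i < r → height p u i < d - walkStep p b) ∧
      height p u r = d - walkStep p b := by
  rw [height_cons]
  constructor
  · rintro ⟨h1, h2⟩
    refine ⟨?_, fun i h h' => ?_, by omega⟩
    · have := h1 1 le_rfl (by omega)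
      simpa [height_zero] using (height_cons p b u 0).symm.trans_lt this
    · have := h1 (i + 1) (by omega) (by omega)
      rw [height_cons] at this
      omega
  · rintro ⟨h0, h1, h2⟩
    refine ⟨fun i h h' => ?_, by omega⟩
    obtain ⟨i, rfl⟩ : ∃ l, i = l + 1 := ⟨i - 1, by omega⟩
    rw [height_cons]
    rcases Nat.eq_zero_or_pos i with rfl | hi
    · rw [height_zero]; omega
    · have := h1 i hi (by omega)
      omega

/-- Condition on the first letter. As r ≥ 1, time 1 precedes the passage, so an up-step needs p < d
strictly, while a down-step is always allowed for d ≥ 0. -/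
lemma firstCount_succ (p : ℕ) {r : ℕ} (hr : 1 ≤ r) {d : ℤ} (hd : 0 ≤ d) :
    firstCount p (r + 1) d =
      (if (p : ℤ) < d then firstCount p r (d - p) else 0) + firstCount p r (d + 1) := by
  unfold firstCount
  rw [wordCount_cons]
  simp only [first_cons_iff p hr]
  congr 1
  · simp only [walkStep, if_true]
    split_ifs with h
    · simp [h]
    · exact wordCount_eq_zero fun u h' => h h'.1
  · simp only [walkStep, Bool.false_eq_true, if_false, sub_neg_eq_add]
    exact wordCount_congr fun u => ⟨fun h => h.2, fun h => ⟨by omega, h⟩⟩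

/-- Staying below 1 is staying nonpositive, and the final step must be an up-step from 1 - p; delete
it. -/
lemma firstCount_one (p : ℕ) (hp : 0 < p) {r : ℕ} :
    firstCount p (r + 1) 1 = nonposCount p r (p - 1) := by
  unfold firstCount nonposCount
  rw [wordCount_snoc]
  have key : ∀ (v : Fin r → Bool) (b : Bool),
      ((∀ i, 1 ≤ i → i < r + 1 → height p (Fin.snoc v b : Fin (r + 1) → Bool) i < 1) ∧
      height p (Fin.snoc v b : Fin (r + 1) → Bool) (r + 1) = 1) ↔
      (∀ i ≤ r, height p v i ≤ 0) ∧ height p v r = 1 - walkStep p b := by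
    intro v b
    rw [height_snoc_last]
    constructor
    · rintro ⟨h1, h2⟩
      refine ⟨fun i hi => ?_, by omega⟩
      rcases Nat.eq_zero_or_pos i with rfl | hi'
      · rw [height_zero]
      · have := h1 i hi' (by omega)
        rw [height_snoc p v b hi] at this
        omega
    · rintro ⟨h1, h2⟩
      refine ⟨fun i hi hi' => ?_, by omega⟩
      rw [height_snoc p v b (by omega)]
      have := h1 i (by omega)
      omega
  simp only [key]
  rw [wordCount_eq_zero (Q := fun v => _ ∧ height p v r = 1 - walkStep p false), add_zero]
  · refine wordCount_congr fun v => ?_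
    rw [show 1 - walkStep p true = -((p - 1 : ℕ) : ℤ) by simp [walkStep]; omega]
  · rintro v ⟨h1, h2⟩
    have := h1 r le_rfl
    simp [walkStep] at h2
    omega

/-! ### Solving the recurrence in the level. -/

/-- The coefficients of the fundamental solution of `U (k+1) = U k - z U (k-p)`. -/
def recCoeff (p k j : ℕ) : ℤ := if j = 0 then 1 else (-1) ^ j * ((k - 1 - p * j).choose j : ℤ)

lemma recCoeff_zero_right (p k : ℕ) : recCoeff p k 0 = 1 := rfl

lemma recCoeff_of_le {p k j : ℕ} (h : k ≤ p + 1) (hj : j ≠ 0) : recCoeff p k j = 0 := by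
  rw [recCoeff, if_neg hj, Nat.choose_eq_zero_of_lt, Nat.cast_zero, mul_zero]
  have : p ≤ p * j := Nat.le_mul_of_pos_right p (Nat.pos_of_ne_zero hj)
  omega

lemma recCoeff_eq_zero_of_lt {p k j : ℕ} (h : k < (p + 1) * j) : recCoeff p k j = 0 := by
  have hj : j ≠ 0 := by rintro rfl; simp at h
  rw [recCoeff, if_neg hj, Nat.choose_eq_zero_of_lt, Nat.cast_zero, mul_zero]
  rw [add_mul] at h
  omega

/-- Pascal's rule; where the natural subtraction truncates and j > 0, all binomials involved vanish.
-/
lemma recCoeff_succ {p k j : ℕ} (h : p < k) :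
    recCoeff p (k + 1) (j + 1) = recCoeff p k (j + 1) - recCoeff p (k - p) j := by
  rcases Nat.eq_zero_or_pos j with rfl | hj
  · simp only [recCoeff, zero_add, one_ne_zero, if_false, if_true, pow_one, mul_one,
      Nat.choose_one_right]
    omega
  · simp only [recCoeff, Nat.add_one_ne_zero, if_false, hj.ne']
    rcases Nat.lt_or_ge (p * (j + 1)) k with h' | h'
    · have e1 : k + 1 - 1 - p * (j + 1) = (k - 1 - p * (j + 1)) + 1 := by omega
      have e2 : k - p - 1 - p * j = k - 1 - p * (j + 1) := by rw [mul_add]; omega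
      rw [e1, e2, Nat.choose_succ_succ]
      push_cast
      ring
    · have e1 : k + 1 - 1 - p * (j + 1) = 0 := by omega
      have e2 : k - 1 - p * (j + 1) = 0 := by omega
      have e3 : k - p - 1 - p * j = 0 := by rw [mul_add] at h'; omega
      rw [e1, e2, e3, Nat.choose_eq_zero_of_lt hj, Nat.choose_eq_zero_of_lt (Nat.succ_pos j)]
      simp

/-- Solve `firstCount_succ` for the highest level. Passing from (r, k+1) to (r+1, k) keeps s,
passing to (r, k-p) lowers s by one, so the variable z of the recurrence acts as the shift of s. -/
theorem firstCount_eq_sum (p : ℕ) (hp : 0 < p) {r k s : ℕ} (hr : 1 ≤ r) (h : r + k = (p + 1) * s) :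
    (firstCount p r k : ℤ) =
      ∑ j ∈ Finset.range s, recCoeff p k j * (firstCount p ((p + 1) * (s - j)) 0 : ℤ) := by
  induction k using Nat.strong_induction_on generalizing r s with
  | _ k ih =>
    obtain ⟨s, rfl⟩ : ∃ l, s = l + 1 := by
      rcases s with _ | s
      · omega
      · exact ⟨s, rfl⟩
    rcases k with _ | k
    · rw [Finset.sum_range_succ', Finset.sum_eq_zero]
      · rw [recCoeff_zero_right, zero_add, one_mul, Nat.sub_zero, ← h]; simp
      · intro j _
        rw [recCoeff_of_le (by omega) (by omega), zero_mul]
    · have h1 := ih k (by omega) (r := r + 1) (s := s + 1) (by omega) (by omega)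
      have h2 := firstCount_succ p hr (d := k) (by omega)
      rw [Finset.sum_range_succ', recCoeff_zero_right] at h1 ⊢
      push_cast
      rcases Nat.lt_or_ge p k with hk | hk
      · have h3 := ih (k - p) (by omega) (r := r) (s := s) hr (by rw [mul_add] at h; omega)
        rw [if_pos (by exact_mod_cast hk)] at h2
        rw [show ((k - p : ℕ) : ℤ) = (k : ℤ) - p by omega] at h3
        simp only [recCoeff_succ hk, sub_mul, Finset.sum_sub_distrib]
        simp only [Nat.add_sub_add_right, Nat.sub_zero] at h1
        have h4 : (firstCount p (r + 1) (k : ℤ) : ℤ) =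
            firstCount p r ((k : ℤ) - p) + firstCount p r ((k : ℤ) + 1) := by exact_mod_cast h2
        linarith
      · rw [if_neg (by omega), zero_add] at h2
        rw [← h2, h1]
        congr 1
        refine Finset.sum_congr rfl fun j _ => ?_
        rw [recCoeff_of_le (by omega) (by omega), recCoeff_of_le (by omega) (by omega), zero_mul,
          zero_mul]

/-- A first return to 0 from below starts with a down-step and ends with an up-step; between them
lies a nonpositive walk ending at -(p-1). -/
lemma firstCount_zero_eq (p : ℕ) (hp : 0 < p) {t : ℕ} (ht : 1 ≤ t) :
    ((p + 1) * t - 1) * firstCount p ((p + 1) * t) 0 =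
      p * ((p + 1) * t - 1).choose (t - 1) := by
  obtain ⟨t, rfl⟩ : ∃ l, t = l + 1 := ⟨t - 1, by omega⟩
  obtain ⟨p, rfl⟩ : ∃ l, p = l + 1 := ⟨p - 1, by omega⟩
  have e : (p + 1 + 1) * (t + 1) = p + (p + 1 + 1) * t + 1 + 1 := by ring
  rw [e, firstCount_succ _ (by omega) le_rfl, if_neg (by omega), zero_add, zero_add,
    firstCount_one _ hp]
  exact succ_mul_nonposCount (p + 1) (by simp)

/-! ### Cutting at the first maximum and matching the explicit formula. -/

/-- The walk has maximum `k` over the times `1, …, N` and first attains it at time `r`. -/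
def IsFirstMax (p : ℕ) {N : ℕ} (w : Fin N → Bool) (r : ℕ) (k : ℤ) : Prop :=
  (∀ i, 1 ≤ i → i < r → height p w i < k) ∧ height p w r = k ∧ ∀ i, r ≤ i → i ≤ N → height p w i ≤ k

lemma wordCount_isFirstMax (p : ℕ) (r q k : ℕ) :
    (wordCount fun w : Fin (r + q) → Bool => IsFirstMax p w r k ∧ height p w (r + q) = 0) =
    firstCount p r k * nonposCount p q k := by
  refine wordCount_append _ _ _ fun u v => ?_
  unfold IsFirstMax
  rw [height_append_left p u v le_rfl, height_append_right]
  constructor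
  · rintro ⟨⟨h1, h2, h3⟩, h4⟩
    refine ⟨⟨fun i hi hi' => ?_, h2⟩, fun i hi => ?_, by omega⟩
    · rw [← height_append_left p u v hi'.le]
      exact h1 i hi hi'
    · have := h3 (r + i) (by omega) (by omega)
      rw [height_append_right] at this
      omega
  · rintro ⟨⟨h1, h2⟩, h3, h4⟩
    refine ⟨⟨fun i hi hi' => ?_, h2, fun i hi hi' => ?_⟩, by omega⟩
    · rw [height_append_left p u v hi'.le]
      exact h1 i hi hi'
    · obtain ⟨i, rfl⟩ := Nat.exists_eq_add_of_le hi
      rw [height_append_right]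
      have := h3 i (by omega)
      omega

lemma height_self (p : ℕ) {N : ℕ} (w : Fin N → Bool) :
    height p w N = (p + 1) * ((Finset.univ.filter fun j => w j = true).card : ℤ) - N := by
  have h : ∀ j : Fin N, (if (j : ℕ) < N then walkStep p (w j) else 0) =
      (p + 1) * (if w j = true then 1 else 0) - 1 := by
    intro j
    rw [if_pos j.isLt, walkStep]
    split_ifs <;> ring
  rw [height, Finset.sum_congr rfl fun j _ => h j, Finset.sum_sub_distrib, ← Finset.mul_sum,
    Finset.card_filter]
  simp

lemma exists_of_wordCount_ne_zero {N : ℕ} {Q : (Fin N → Bool) → Prop} (h : wordCount Q ≠ 0) :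
    ∃ w, Q w := by
  by_contra! h'
  exact h (wordCount_eq_zero h')

lemma wordCount_isFirstMax_of_eq (p : ℕ) {N r q : ℕ} (k : ℕ) (h : N = r + q) :
    (wordCount fun w : Fin N → Bool => IsFirstMax p w r k ∧ height p w N = 0) =
    firstCount p r k * nonposCount p q k := by
  subst h
  exact wordCount_isFirstMax p r q k

/-- Upper negation of the binomial coefficient, which produces the sign (-1)^j. -/
lemma ringChoose_eq_recCoeff (p : ℕ) {k j : ℕ} (h : (p + 1) * j ≤ k) :
    Ring.choose ((j : ℝ) * ((p : ℝ) + 1) - (k : ℝ)) j = (recCoeff p k j : ℝ) := by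
  rcases Nat.eq_zero_or_pos j with rfl | hj
  · simp [recCoeff]
  · have h' : p * j + 1 ≤ k := by rw [add_mul] at h; omega
    have e : (j : ℝ) * ((p : ℝ) + 1) - (k : ℝ) = -((k - 1 - p * j : ℕ) + 1 - (j : ℝ)) := by
      rw [Nat.cast_sub (by omega), Nat.cast_sub (by omega)]
      push_cast
      ring
    rw [e, Ring.choose_neg, recCoeff, if_neg hj.ne',
      show ((k - 1 - p * j : ℕ) : ℝ) + 1 - (j : ℝ) + j - 1 = ((k - 1 - p * j : ℕ) : ℝ) by ring,
      Ring.choose_natCast]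
    simp [Units.smul_def, Int.negOnePow_def]

lemma summand_eq_firstCount (p : ℕ) (hp : 0 < p) {r k s j : ℕ} (hr : 1 ≤ r)
    (h : r + k = (p + 1) * s) (hj : (p + 1) * j ≤ k) :
    (p : ℝ) / ((r : ℝ) + k - 1 - j * ((p : ℝ) + 1)) *
        Ring.choose ((j : ℝ) * ((p : ℝ) + 1) - k) j *
        Ring.choose ((r : ℝ) + k - 1 - j * ((p : ℝ) + 1)) (s - 1 - j) =
      recCoeff p k j * (firstCount p ((p + 1) * (s - j)) 0 : ℝ) := by
  have hjs : j < s := by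
    by_contra! hc
    have := Nat.mul_le_mul_left (p + 1) hc
    omega
  obtain ⟨t, rfl⟩ : ∃ t, s = j + (t + 1) := ⟨s - j - 1, by omega⟩
  have e : (r : ℝ) + k - 1 - j * ((p : ℝ) + 1) = (((p + 1) * (t + 1) - 1 : ℕ) : ℝ) := by
    have h1 : 1 ≤ (p + 1) * (t + 1) := Nat.mul_pos (by omega) (by omega)
    have h2 : (r : ℝ) + k = (p + 1) * (j + (t + 1)) := by exact_mod_cast h
    rw [Nat.cast_sub h1, h2]
    push_cast
    ring
  have hpos : 0 < (p + 1) * (t + 1) - 1 := by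
    have : (p + 1) * (t + 1) = p + 1 + p * t + t := by ring
    omega
  have hA := firstCount_zero_eq p hp (t := t + 1) (by omega)
  rw [ringChoose_eq_recCoeff p hj, e, Ring.choose_natCast, Nat.add_sub_cancel_left,
    show j + (t + 1) - 1 - j = t + 1 - 1 by omega]
  have hA' : (((p + 1) * (t + 1) - 1 : ℕ) : ℝ) * (firstCount p ((p + 1) * (t + 1)) 0 : ℝ) =
      p * (((p + 1) * (t + 1) - 1).choose (t + 1 - 1) : ℝ) := by exact_mod_cast hA
  have hne : (((p + 1) * (t + 1) - 1 : ℕ) : ℝ) ≠ 0 := by exact_mod_cast hpos.ne'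
  rw [eq_div_iff hne |>.2 ((mul_comm _ _).trans hA') ]
  ring

theorem gutjahrProb_eq (n p : ℕ) (hn : 0 < n) (hp : 0 < p) {r k : ℕ} (hr : 1 ≤ r)
    (hrN : r ≤ n + n * p) :
    gutjahrProb n (n * p) r k =
      (wordCount fun w : Fin (n + n * p) → Bool =>
        IsFirstMax p w r k ∧ height p w (n + n * p) = 0 : ℝ) / ((n + n * p).choose n : ℝ) := by
  obtain ⟨q, hq⟩ := Nat.exists_eq_add_of_le hrN
  have hN : n + n * p = n * (p + 1) := by ring
  have hn0 : (n : ℝ) ≠ 0 := by exact_mod_cast hn.ne'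
  rw [wordCount_isFirstMax_of_eq p k hq]
  have hdvd : n + n * p ∣ (r + k) * n ↔ p + 1 ∣ r + k := by
    rw [hN, mul_comm (r + k) n]
    exact Nat.mul_dvd_mul_iff_left hn
  have hs : (r + k) * n / (n + n * p) = (r + k) / (p + 1) := by
    rw [hN, mul_comm (r + k) n, Nat.mul_div_mul_left _ _ hn]
  have hJ : n * k / (n + n * p) = k / (p + 1) := by
    rw [hN, Nat.mul_div_mul_left _ _ hn]
  have hc : ((n : ℝ) + ((n * p : ℕ) : ℝ)) / (n : ℝ) = (p : ℝ) + 1 := by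
    push_cast
    field_simp
    ring
  have hmn : ((n * p : ℕ) : ℝ) / (n : ℝ) = p := by
    push_cast
    field_simp
  simp only [gutjahrProb, hdvd, hs, hJ, hc, hmn]
  split_ifs with h
  · obtain ⟨⟨s, hs'⟩, h2⟩ := h
    have hdiv : (r + k) / (p + 1) = s := by
      rw [hs', Nat.mul_div_cancel_left _ (Nat.succ_pos p)]
    rw [hdiv] at h2 ⊢
    have hsn : s ≤ n := h2.trans (min_le_right _ _)
    obtain ⟨u, rfl⟩ := Nat.exists_eq_add_of_le hsn
    have hqk : q = k + (p + 1) * u := by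
      have : (p + 1) * (s + u) = (p + 1) * s + (p + 1) * u := by ring
      have h3 : (s + u) * (p + 1) = (p + 1) * (s + u) := mul_comm _ _
      omega
    have hV := succ_mul_nonposCount p hqk
    have hV' : ((q : ℝ) + 1) * (nonposCount p q k : ℝ) = (k + 1) * ((q + 1).choose u : ℝ) := by
      exact_mod_cast hV
    have hq1 : ((q : ℝ) + 1) ≠ 0 := by positivity
    have hsum : ∑ j ∈ Finset.range (k / (p + 1) + 1),
        (p : ℝ) / ((r : ℝ) + k - 1 - j * ((p : ℝ) + 1)) *
        Ring.choose ((j : ℝ) * ((p : ℝ) + 1) - k) j *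
        Ring.choose ((r : ℝ) + k - 1 - j * ((p : ℝ) + 1)) (s - 1 - j) = firstCount p r k := by
      have hA : (firstCount p r k : ℝ) = ∑ j ∈ Finset.range s,
          recCoeff p k j * (firstCount p ((p + 1) * (s - j)) 0 : ℝ) := by
        exact_mod_cast firstCount_eq_sum p hp hr hs'
      rw [hA, Finset.sum_congr rfl fun j hj => summand_eq_firstCount p hp hr hs' ?_]
      -- The two ranges of j differ only where (p+1)j > k, and there `recCoeff` vanishes.
      · refine Finset.sum_subset (fun j hj => ?_) fun j _ hj => ?_
        · rw [Finset.mem_range] at hj ⊢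
          have h1 : (p + 1) * j ≤ k := by
            rw [mul_comm]; exact (Nat.le_div_iff_mul_le (by omega : 0 < p + 1)).1 (by omega)
          by_contra! hcon
          have := Nat.mul_le_mul_left (p + 1) hcon
          omega
        · rw [Finset.mem_range, not_lt] at hj
          have h1 : k < (p + 1) * j := by
            rw [mul_comm]; exact (Nat.div_lt_iff_lt_mul (by omega : 0 < p + 1)).1 (by omega)
          rw [recCoeff_eq_zero_of_lt h1, Int.cast_zero, zero_mul]
      · rw [Finset.mem_range] at hj
        rw [mul_comm]; exact (Nat.le_div_iff_mul_le (by omega : 0 < p + 1)).1 (by omega)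
    rw [hsum, Nat.add_sub_cancel_left, show (s + u) + (s + u) * p - r + 1 = q + 1 by omega]
    have hNr : ((s + u : ℕ) : ℝ) + (((s + u) * p : ℕ) : ℝ) - r + 1 = q + 1 := by
      have : ((s + u : ℕ) : ℝ) + (((s + u) * p : ℕ) : ℝ) = r + q := by exact_mod_cast hq
      rw [this]; ring
    rw [hNr, Nat.cast_mul, eq_div_iff hq1 |>.2 ((mul_comm _ _).trans hV')]
    field_simp
  · rw [eq_comm, div_eq_zero_iff]
    left
    rw [Nat.cast_eq_zero]
    -- If a word existed, s would be the number of up-steps in its head: an integer, at most r, and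
    -- at most n because the tail has a nonnegative number of up-steps.
    by_contra hne
    rw [mul_eq_zero, not_or] at hne
    obtain ⟨w, -, hw⟩ := exists_of_wordCount_ne_zero hne.1
    obtain ⟨v, -, hv⟩ := exists_of_wordCount_ne_zero hne.2
    rw [height_self] at hw hv
    set a := (Finset.univ.filter fun j => w j = true).card with ha
    set b := (Finset.univ.filter fun j => v j = true).card
    have har : a ≤ r := (Finset.card_le_univ _).trans_eq (Fintype.card_fin r)
    have h1 : r + k = (p + 1) * a := by zify; linarith
    have h2 : (p + 1) * a ≤ (p + 1) * n := by
      have h3 : 0 ≤ ((p : ℤ) + 1) * (b : ℤ) := by positivity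
      rw [← h1, mul_comm, ← hN]
      omega
    refine h ⟨⟨a, h1⟩, ?_⟩
    rw [h1, Nat.mul_div_cancel_left _ (Nat.succ_pos p)]
    exact le_min har (Nat.le_of_mul_le_mul_left h2 (Nat.succ_pos p))

/-! ### The boundary case r = n+m. -/

/-- Here s = n would force k = 0; a positive k makes s exceed n. -/
lemma gutjahrProb_last_of_pos (n p : ℕ) (hn : 0 < n) {k : ℕ} (hk : 0 < k) :
    gutjahrProb n (n * p) (n + n * p) k = 0 := by
  rw [gutjahrProb]
  refine if_neg fun h => ?_
  have h1 := Nat.div_mul_cancel h.1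
  have h2 := h.2.trans (min_le_right _ _)
  have h3 : (n + n * p + k) * n ≤ n * (n + n * p) := by
    rw [← h1]; exact Nat.mul_le_mul_right _ h2
  nlinarith

lemma gutjahrProb_last_zero (n p : ℕ) (hn : 0 < n) (hp : 0 < p) :
    gutjahrProb n (n * p) (n + n * p) 0 =
      ((n * p : ℕ) : ℝ) / (((n : ℝ) + (n * p : ℕ)) * ((n : ℝ) + (n * p : ℕ) - 1)) := by
  have hnp : 0 < n * p := Nat.mul_pos hn hp
  have hs : (n + n * p + 0) * n / (n + n * p) = n := by
    rw [add_zero, Nat.mul_div_cancel_left _ (by omega)]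
  simp only [gutjahrProb, hs]
  rw [if_pos ⟨⟨n, by ring⟩, le_min (by omega) le_rfl⟩]
  obtain ⟨N, hN⟩ : ∃ N, n + n * p = N + 1 := ⟨n + n * p - 1, by omega⟩
  obtain ⟨l, rfl⟩ : ∃ l, n = l + 1 := ⟨n - 1, by omega⟩
  have hNR : ((l + 1 : ℕ) : ℝ) + (((l + 1) * p : ℕ) : ℝ) = N + 1 := by exact_mod_cast hN
  have e : ((N + 1 : ℕ) : ℝ) + ((0 : ℕ) : ℝ) - 1 - ((0 : ℕ) : ℝ) * ((N + 1) / ((l + 1 : ℕ) : ℝ)) =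
      (N : ℝ) := by push_cast; ring
  have hch : ((N : ℝ) + 1) * (N.choose l : ℝ) = ((N + 1).choose (l + 1) : ℝ) * (l + 1) := by
    exact_mod_cast Nat.add_one_mul_choose_eq N l
  have hC : ((N + 1).choose (l + 1) : ℝ) ≠ 0 := by
    exact_mod_cast (Nat.choose_pos (by omega)).ne'
  have hN0 : (N : ℝ) ≠ 0 := by
    have : N ≠ 0 := by omega
    exact_mod_cast this
  rw [hNR, hN]
  simp only [mul_zero, Nat.zero_div, zero_add, Finset.sum_range_one, e, Ring.choose_zero_right,
    Nat.sub_zero, Nat.add_sub_cancel, Ring.choose_natCast]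
  simp only [Nat.sub_self, Nat.choose_zero_right, Nat.cast_add, Nat.cast_one, Nat.cast_zero,
    zero_add, sub_self, add_sub_cancel_right]
  have hl : ((l : ℝ) + 1) ≠ 0 := by positivity
  field_simp
  linear_combination hch

/-! ### From orderings to words. -/

/-- The word of a permutation of the pooled indices: letter `i` is `true` when the `i`-th position
is occupied by one of the first `n` indices. -/
def permWord (n : ℕ) {N : ℕ} (σ : Equiv.Perm (Fin N)) (i : Fin N) : Bool := decide ((σ i : ℕ) < n)

lemma card_filter_permWord (n m : ℕ) (σ : Equiv.Perm (Fin (n + m))) :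
    (Finset.univ.filter fun j => permWord n σ j = true).card = n := by
  rw [Finset.card_filter, ← Equiv.sum_comp σ.symm, Fin.sum_univ_add]
  simp [permWord]

lemma exists_permWord_eq (n m : ℕ) (w : Fin (n + m) → Bool)
    (hw : (Finset.univ.filter fun j => w j = true).card = n) :
    ∃ σ : Equiv.Perm (Fin (n + m)), permWord n σ = w := by
  have h1 := card_filter_permWord n m 1
  have hc : Fintype.card {j // w j = true} =
      Fintype.card {j : Fin (n + m) // permWord n 1 j = true} := by
    rw [Fintype.card_subtype, Fintype.card_subtype, hw, h1]
  let e := Fintype.equivOfCardEq hc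
  refine ⟨e.extendSubtype, funext fun i => ?_⟩
  have hval : permWord n e.extendSubtype i = permWord n 1 (e.extendSubtype i) := rfl
  rw [hval]
  by_cases hi : w i = true
  · rw [hi]; exact e.extendSubtype_mem i hi
  · rw [Bool.eq_false_iff.2 hi, Bool.eq_false_iff]; exact e.extendSubtype_not_mem i hi

/-- Right multiplication by τ⁻¹ carries the fiber over the word of τ to the fiber over the word of
the identity. -/
lemma card_permWord_fiber (n : ℕ) {N : ℕ} (τ : Equiv.Perm (Fin N)) :
    (Finset.univ.filter fun σ : Equiv.Perm (Fin N) => permWord n σ = permWord n τ).card =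
      (Finset.univ.filter fun σ : Equiv.Perm (Fin N) => permWord n σ = permWord n 1).card := by
  refine Finset.card_equiv (Equiv.mulRight τ⁻¹) fun σ => ?_
  simp only [Finset.mem_filter, Finset.mem_univ, true_and, Equiv.coe_mulRight]
  constructor
  · intro h
    funext i
    have h1 : τ (τ⁻¹ i) = i := τ.apply_symm_apply i
    calc permWord n (σ * τ⁻¹) i = permWord n τ (τ⁻¹ i) := congrFun h (τ⁻¹ i)
      _ = permWord n 1 i := by rw [permWord, h1]; rfl
  · intro h
    funext i
    have h1 : τ⁻¹ (τ i) = i := τ.symm_apply_apply i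
    calc permWord n σ i = permWord n (σ * τ⁻¹) (τ i) := by
          rw [permWord, permWord, Equiv.Perm.mul_apply, h1]
      _ = permWord n τ i := congrFun h (τ i)

open Classical in
lemma card_permWord (n m : ℕ) (Q : (Fin (n + m) → Bool) → Prop) :
    (Finset.univ.filter fun σ : Equiv.Perm (Fin (n + m)) => Q (permWord n σ)).card =
      wordCount (fun w => Q w ∧ (Finset.univ.filter fun j => w j = true).card = n) *
      (Finset.univ.filter fun σ : Equiv.Perm (Fin (n + m)) => permWord n σ = permWord n 1).card := by
  rw [wordCount_eq_card, Finset.card_eq_sum_card_fiberwise (f := permWord n)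
    (t := Finset.univ.filter fun w : Fin (n + m) → Bool =>
      Q w ∧ (Finset.univ.filter fun j => w j = true).card = n)]
  · refine Finset.sum_const_nat fun w hw => ?_
    obtain ⟨hQ, hn⟩ := (Finset.mem_filter.1 hw).2
    obtain ⟨τ, rfl⟩ := exists_permWord_eq n m w hn
    rw [← card_permWord_fiber n τ, Finset.filter_filter]
    congr 1
    ext σ
    simp only [Finset.mem_filter, Finset.mem_univ, true_and]
    exact ⟨fun h => h.2, fun h => ⟨h ▸ hQ, h⟩⟩
  · intro σ hσ
    simp only [Finset.coe_filter, Finset.mem_univ, true_and, Set.mem_ofPred_eq] at hσ ⊢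
    exact ⟨hσ, card_filter_permWord n m σ⟩

lemma wordCount_card_eq (N n : ℕ) :
    wordCount (fun w : Fin N → Bool => (Finset.univ.filter fun j => w j = true).card = n) =
      N.choose n := by
  classical
  rw [wordCount]
  trans (Finset.powersetCard n (Finset.univ : Finset (Fin N))).card
  · refine Finset.card_bij' (fun w _ => Finset.univ.filter fun j => w j = true)
      (fun A _ j => decide (j ∈ A)) ?_ ?_ ?_ ?_
    · intro w hw
      simpa [Finset.mem_powersetCard] using hw
    · intro A hA
      simpa [Finset.mem_powersetCard] using hA
    · intro w _; simp
    · intro A _; simp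
  · simp

open Classical in
theorem card_permWord_div (n m : ℕ) (Q : (Fin (n + m) → Bool) → Prop) :
    ((Finset.univ.filter fun σ : Equiv.Perm (Fin (n + m)) => Q (permWord n σ)).card : ℝ) /
      ((n + m).factorial : ℝ) =
    (wordCount (fun w => Q w ∧ (Finset.univ.filter fun j => w j = true).card = n) : ℝ) /
      ((n + m).choose n : ℝ) := by
  -- The trivial property gives (n+m)! as binomial times fiber size, so the fiber size cancels
  -- without being computed.
  have h1 := card_permWord n m (fun _ => True)
  simp only [Finset.filter_true, true_and, wordCount_card_eq, Finset.card_univ, Fintype.card_perm,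
    Fintype.card_fin] at h1
  rw [card_permWord, h1]
  have hf : (n + m).choose n *
      (Finset.univ.filter fun σ : Equiv.Perm (Fin (n + m)) => permWord n σ = permWord n 1).card
      ≠ 0 := h1 ▸ Nat.factorial_ne_zero _
  have hf2 : ((Finset.univ.filter fun σ : Equiv.Perm (Fin (n + m)) =>
    permWord n σ = permWord n 1).card : ℝ) ≠ 0 := by exact_mod_cast (mul_ne_zero_iff.1 hf).2
  push_cast
  rw [mul_div_mul_right _ _ hf2]

/-! ### The statistics as functionals of the walk. -/

section Statistics

variable {n m p : ℕ} {x : Fin n → ℝ} {y : Fin m → ℝ} {σ : Equiv.Perm (Fin (n + m))}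

lemma height_permWord_last (n p : ℕ) (σ : Equiv.Perm (Fin (n + n * p))) :
    height p (permWord n σ) (n + n * p) = 0 := by
  rw [height_self, card_filter_permWord]
  push_cast
  ring

lemma height_permWord_le (n p : ℕ) {m : ℕ} (σ : Equiv.Perm (Fin (n + m))) (i : ℕ) :
    height p (permWord n σ) i ≤ n * p := by
  have h : height p (permWord n σ) i ≤
      ∑ j, if permWord n σ j = true then (p : ℤ) else 0 := by
    refine Finset.sum_le_sum fun j _ => ?_
    unfold walkStep
    split_ifs <;> omega
  refine h.trans_eq ?_
  rw [← Finset.sum_filter, Finset.sum_const, card_filter_permWord]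
  simp

/-- The difference of the empirical distribution functions is a rescaled walk. -/
lemma empiricalDF_sub_eq (hn : 0 < n) (hp : 0 < p) (hm : m = n * p) {t : ℝ} {i : ℕ}
    (hi : ∀ j : Fin (n + m), (j : ℕ) < i ↔ Fin.append x y (σ j) ≤ t) :
    empiricalDF x t - empiricalDF y t = (height p (permWord n σ) i : ℝ) / (m : ℝ) := by
  have h : height p (permWord n σ) i =
      p * ((Finset.univ.filter fun i => x i ≤ t).card : ℤ) -
        (Finset.univ.filter fun i => y i ≤ t).card := by
    rw [height]
    simp only [hi, permWord]
    rw [Equiv.sum_comp σ fun l => if Fin.append x y l ≤ t then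
      walkStep p (decide ((l : ℕ) < n)) else 0, Fin.sum_univ_add]
    simp [walkStep, Finset.sum_ite, mul_comm, sub_eq_add_neg]
  have hn0 : (n : ℝ) ≠ 0 := by exact_mod_cast hn.ne'
  have hp0 : (p : ℝ) ≠ 0 := by exact_mod_cast hp.ne'
  have hmR : (m : ℝ) = n * p := by exact_mod_cast hm
  rw [h, empiricalDF, empiricalDF, hmR]
  push_cast
  field_simp

lemma orderStat_eq (hσ : StrictMono (Fin.append x y ∘ σ)) (j : Fin (n + m)) :
    orderStat x y j = Fin.append x y (σ j) :=
  congrFun (Tuple.unique_monotone (Tuple.monotone_sort (Fin.append x y)) hσ.monotone) j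

lemma empiricalDF_sub_orderStat (hn : 0 < n) (hp : 0 < p) (hm : m = n * p)
    (hσ : StrictMono (Fin.append x y ∘ σ)) (j : Fin (n + m)) :
    empiricalDF x (orderStat x y j) - empiricalDF y (orderStat x y j) =
      (height p (permWord n σ) (j + 1) : ℝ) / (m : ℝ) := by
  refine empiricalDF_sub_eq hn hp hm fun l => ?_
  rw [orderStat_eq hσ, Nat.lt_succ_iff, ← Fin.le_def]
  exact hσ.le_iff_le.symm

lemma statD_eq_of_isFirstMax (hn : 0 < n) (hp : 0 < p) (hm : m = n * p)
    (hσ : StrictMono (Fin.append x y ∘ σ)) {r : ℕ} {k : ℤ} (hr : 1 ≤ r) (hrN : r ≤ n + m)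
    (h : IsFirstMax p (permWord n σ) r k) : statD x y = (k : ℝ) / (m : ℝ) := by
  have hle : ∀ i ≤ n + m, height p (permWord n σ) i ≤ k := by
    intro i hi
    rcases Nat.eq_zero_or_pos i with rfl | hi0
    -- Time 0, which corresponds to t below all observations, is excluded from the first maximum but
    -- has the same height as the final time.
    · rw [height_zero]
      subst hm
      exact (height_permWord_last n p σ).symm.trans_le (h.2.2 _ hrN le_rfl)
    · rcases Nat.lt_or_ge i r with hir | hir
      · exact (h.1 i hi0 hir).le
      · exact h.2.2 i hir hi
  have hub : ∀ t, empiricalDF x t - empiricalDF y t ≤ (k : ℝ) / (m : ℝ) := by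
    intro t
    rw [empiricalDF_sub_eq hn hp hm (t := t)
      -- The time matching t is the number of pooled observations at most t.
      (i := (Finset.univ.filter fun l => (Fin.append x y ∘ σ) l ≤ t).card)
      fun j => Tuple.lt_card_le_iff_apply_le_of_monotone hσ.monotone]
    gcongr
    exact_mod_cast hle _ ((Finset.card_le_univ _).trans_eq (Fintype.card_fin _))
  refine le_antisymm (ciSup_le hub) ?_
  have h1 := empiricalDF_sub_orderStat hn hp hm hσ ⟨r - 1, by omega⟩
  simp only [Nat.sub_add_cancel hr, h.2.1] at h1
  rw [← h1]
  exact le_ciSup (f := fun t => empiricalDF x t - empiricalDF y t)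
    ⟨(k : ℝ) / m, by rintro _ ⟨t, rfl⟩; exact hub t⟩ _

lemma statR_eq_of_isFirstMax (hn : 0 < n) (hp : 0 < p) (hm : m = n * p)
    (hσ : StrictMono (Fin.append x y ∘ σ)) {r : ℕ} {k : ℤ} (hr : 1 ≤ r) (hrN : r ≤ n + m)
    (h : IsFirstMax p (permWord n σ) r k) : statR x y = r := by
  have hm0 : (m : ℝ) ≠ 0 := by
    rw [hm]; exact_mod_cast (Nat.mul_pos hn hp).ne'
  have hset : {i : ℕ | ∃ j : Fin (n + m), i = (j : ℕ) + 1 ∧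
      empiricalDF x (orderStat x y j) - empiricalDF y (orderStat x y j) = statD x y} =
      {i | 1 ≤ i ∧ i ≤ n + m ∧ height p (permWord n σ) i = k} := by
    ext i
    simp only [Set.mem_ofPred_eq, empiricalDF_sub_orderStat hn hp hm hσ,
      statD_eq_of_isFirstMax hn hp hm hσ hr hrN h, div_left_inj' hm0, Int.cast_inj]
    constructor
    · rintro ⟨j, rfl, hj⟩
      exact ⟨by omega, j.isLt, hj⟩
    · rintro ⟨h1, h2, h3⟩
      exact ⟨⟨i - 1, by omega⟩, by simp only; omega, by simpa only [Nat.sub_add_cancel h1] using h3⟩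
  rw [statR, hset]
  refine le_antisymm (Nat.sInf_le ⟨hr, hrN, h.2.1⟩) (le_csInf ⟨r, hr, hrN, h.2.1⟩ ?_)
  rintro i ⟨h1, -, h3⟩
  by_contra! hlt
  exact (h.1 i h1 hlt).ne h3

lemma exists_isFirstMax (hn : 0 < n) (σ : Equiv.Perm (Fin (n + n * p))) :
    ∃ r k : ℕ, (1 ≤ r ∧ r ≤ n + n * p) ∧ k ≤ n * p ∧ IsFirstMax p (permWord n σ) r k := by
  classical
  obtain ⟨a, ha, hmax⟩ := (Finset.Icc 1 (n + n * p)).exists_max_image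
    (height p (permWord n σ)) ⟨n + n * p, Finset.mem_Icc.2 ⟨by omega, le_rfl⟩⟩
  -- The walk ends at 0, so its maximum is a natural number.
  have h0 : 0 ≤ height p (permWord n σ) a := by
    rw [← height_permWord_last n p σ]
    exact hmax _ (Finset.mem_Icc.2 ⟨by omega, le_rfl⟩)
  have hex : ∃ i, i ∈ Finset.Icc 1 (n + n * p) ∧
      height p (permWord n σ) i = height p (permWord n σ) a := ⟨a, ha, rfl⟩
  obtain ⟨hr, hra⟩ := Nat.find_spec hex
  have hle := height_permWord_le n p σ a
  obtain ⟨k, hk⟩ := Int.eq_ofNat_of_zero_le h0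
  rw [Finset.mem_Icc] at hr
  refine ⟨Nat.find hex, k, hr, by rw [hk] at hle; exact_mod_cast hle, ?_, hra.trans hk, ?_⟩
  · intro i hi hir
    have hmem : i ∈ Finset.Icc 1 (n + n * p) := Finset.mem_Icc.2 ⟨hi, by omega⟩
    rw [← hk]
    exact lt_of_le_of_ne (hmax i hmem) fun he => Nat.find_min hex hir ⟨hmem, he⟩
  · intro i hi hiN
    rw [← hk]
    exact hmax i (Finset.mem_Icc.2 ⟨by omega, hiN⟩)

end Statistics

lemma IsFirstMax.unique {p N : ℕ} {w : Fin N → Bool} {r r' : ℕ} {k k' : ℤ} (hr : 1 ≤ r)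
    (hrN : r ≤ N) (hr' : 1 ≤ r') (hrN' : r' ≤ N) (h : IsFirstMax p w r k)
    (h' : IsFirstMax p w r' k') : r = r' ∧ k = k' := by
  rcases lt_trichotomy r r' with hlt | rfl | hlt
  · have h1 := h'.1 r hr hlt
    have h2 := h.2.2 r' hlt.le hrN'
    rw [h.2.1] at h1
    rw [h'.2.1] at h2
    omega
  · exact ⟨rfl, h.2.1.symm.trans h'.2.1⟩
  · have h1 := h.1 r' hr' hlt
    have h2 := h'.2.2 r hlt.le hrN
    rw [h'.2.1] at h1
    rw [h.2.1] at h2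
    omega

open Classical in
theorem card_isFirstMax_div (n p : ℕ) (hn : 0 < n) (hp : 0 < p) {r k : ℕ} (hr : 1 ≤ r)
    (hrN : r ≤ n + n * p) :
    ((Finset.univ.filter fun σ : Equiv.Perm (Fin (n + n * p)) =>
      IsFirstMax p (permWord n σ) r k).card : ℝ) / ((n + n * p).factorial : ℝ) =
    gutjahrProb n (n * p) r k := by
  rw [gutjahrProb_eq n p hn hp hr hrN,
    card_permWord_div n (n * p) (fun w => IsFirstMax p w r k)]
  congr 2
  refine wordCount_congr fun w => and_congr_right fun _ => ?_
  rw [height_self]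
  constructor
  · intro h
    rw [h]; push_cast; ring
  · intro h
    have h1 : ((p : ℤ) + 1) * ((Finset.univ.filter fun j => w j = true).card : ℤ) =
        (p + 1) * n := by push_cast at h; linarith
    exact_mod_cast mul_left_cancel₀ (by positivity : ((p : ℤ) + 1) ≠ 0) h1

/-! ### Equally likely orderings of an i.i.d. sample. -/

lemma nullSingletonClass_of_continuous_cdf (μ : Measure ℝ) [IsProbabilityMeasure μ] {F : ℝ → ℝ}
    (hF : Continuous F) (h : ∀ t, μ.real (Set.Iic t) = F t) : NullSingletonClass μ := by
  have hcdf : ⇑(cdf μ) = F := funext fun t => (cdf_eq_real μ t).trans (h t)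
  refine ⟨fun a => ?_⟩
  rw [← measure_cdf μ, StieltjesFunction.measure_singleton, hcdf,
    hF.continuousAt.continuousWithinAt.leftLim_eq]
  simp

lemma measurableSet_strictMono_comp {N : ℕ} (σ : Equiv.Perm (Fin N)) :
    MeasurableSet {z : Fin N → ℝ | StrictMono (z ∘ σ)} := by
  have : {z : Fin N → ℝ | StrictMono (z ∘ σ)} =
      ⋂ i : Fin N, ⋂ j : Fin N, ⋂ _ : i < j, {z | z (σ i) < z (σ j)} := by
    ext z
    simp [StrictMono, Set.mem_iInter]
  rw [this]
  exact MeasurableSet.iInter fun i => MeasurableSet.iInter fun j => MeasurableSet.iInter fun _ =>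
    measurableSet_lt (measurable_pi_apply _) (measurable_pi_apply _)

lemma pi_strictMono_comp (μ : Measure ℝ) [IsProbabilityMeasure μ] {N : ℕ}
    (σ : Equiv.Perm (Fin N)) :
    (Measure.pi fun _ : Fin N => μ) {z | StrictMono (z ∘ σ)} =
      (Measure.pi fun _ : Fin N => μ) {z | StrictMono z} := by
  have h := measurePreserving_piCongrLeft (α := fun _ : Fin N => ℝ) (fun _ => μ) σ
  rw [← h.measure_preimage (measurableSet_strictMono_comp σ).nullMeasurableSet]
  congr 1
  ext z
  simp only [Set.mem_preimage, Set.mem_ofPred_eq]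
  rw [show (MeasurableEquiv.piCongrLeft (fun _ : Fin N => ℝ) σ z) ∘ σ = z from
    funext fun i => Equiv.piCongrLeft_apply_apply (fun _ : Fin N => ℝ) σ z i]

open Classical in
/-- For an i.i.d. sample with a non-atomic law, all orderings are equally likely. -/
theorem measureReal_eq_card_div {Ω : Type*} [MeasurableSpace Ω] (P : Measure Ω)
    [IsProbabilityMeasure P] (μ : Measure ℝ) [IsProbabilityMeasure μ] [NullSingletonClass μ] {N : ℕ}
    (Z : Fin N → Ω → ℝ) (hZ : ∀ i, Measurable (Z i)) (hind : iIndepFun Z P)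
    (hμ : ∀ i, P.map (Z i) = μ) (Q : (Fin N → ℝ) → Prop) (q : Equiv.Perm (Fin N) → Prop)
    (hQ : ∀ (z : Fin N → ℝ) (σ : Equiv.Perm (Fin N)), StrictMono (z ∘ σ) →
      (Q z ↔ q σ)) :
    P.real {ω | Q fun i => Z i ω} = ((Finset.univ.filter q).card : ℝ) / (N.factorial : ℝ) := by
  have hZm : Measurable fun ω i => Z i ω := measurable_pi_lambda _ hZ
  have hmap : P.map (fun ω i => Z i ω) = Measure.pi fun _ : Fin N => μ := by
    rw [(iIndepFun_iff_map_fun_eq_pi_map fun i => (hZ i).aemeasurable).1 hind]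
    simp only [hμ]
  let E : Equiv.Perm (Fin N) → Set Ω := fun σ => {ω | StrictMono ((fun i => Z i ω) ∘ σ)}
  have hEm : ∀ σ, MeasurableSet (E σ) := fun σ => hZm (measurableSet_strictMono_comp σ)
  have hE : ∀ σ, P.real (E σ) = P.real (E 1) := by
    have h1 : ∀ σ, P (E σ) = (Measure.pi fun _ : Fin N => μ) {z | StrictMono z} := fun σ => by
      rw [← pi_strictMono_comp μ σ, ← hmap, Measure.map_apply hZm (measurableSet_strictMono_comp σ)]
      rfl
    intro σ
    rw [measureReal_def, measureReal_def, h1, h1]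
  have hinj : ∀ᵐ ω ∂P, Function.Injective fun i => Z i ω := by
    have hne : ∀ i j, i ≠ j → ∀ᵐ ω ∂P, Z i ω ≠ Z j ω := by
      intro i j hij
      have h1 := (indepFun_iff_map_prod_eq_prod_map_map (hZ i).aemeasurable
        (hZ j).aemeasurable).1 (hind.indepFun hij)
      rw [hμ, hμ] at h1
      -- By Fubini the diagonal is null, since each of its sections is a point.
      have h2 : (μ.prod μ) (Set.diagonal ℝ) = 0 := by
        refine Measure.measure_prod_null_of_ae_null measurableSet_diagonal
          (Filter.Eventually.of_forall fun a => ?_)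
        have : Prod.mk a ⁻¹' Set.diagonal ℝ = {a} := by ext b; simp [eq_comm]
        simp [this]
      rw [← h1, Measure.map_apply ((hZ i).prodMk (hZ j)) measurableSet_diagonal] at h2
      rw [ae_iff]
      simpa [Set.preimage] using h2
    have hall : ∀ᵐ ω ∂P, ∀ i j, i ≠ j → Z i ω ≠ Z j ω :=
      ae_all_iff.2 fun i => ae_all_iff.2 fun j => by
        by_cases hij : i = j
        · simp [hij]
        · simpa [hij] using hne i j hij
    filter_upwards [hall] with ω hω i j h
    by_contra hij
    exact hω i j hij h
  have hdisj : ∀ s : Finset (Equiv.Perm (Fin N)), (s : Set (Equiv.Perm (Fin N))).PairwiseDisjoint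
      E := by
    intro s σ _ τ _ hστ
    refine Set.disjoint_left.2 fun ω h1 h2 => hστ ?_
    have h3 : StrictMono ((fun i => Z i ω) ∘ σ) := h1
    have h4 : StrictMono ((fun i => Z i ω) ∘ τ) := h2
    have h5 := Tuple.unique_monotone h3.monotone h4.monotone
    have hi : Function.Injective fun i => Z i ω := by
      have := h3.injective.comp σ.symm.injective
      rwa [Function.comp_assoc, Equiv.self_comp_symm, Function.comp_id] at this
    exact Equiv.ext fun i => hi (congrFun h5 i)
  have hfin : ∀ s : Finset (Equiv.Perm (Fin N)), P.real (⋃ σ ∈ s, E σ) = s.card * P.real (E 1) := by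
    intro s
    rw [measureReal_biUnion_finset (hdisj s) fun σ _ => hEm σ, Finset.sum_congr rfl fun σ _ => hE σ,
      Finset.sum_const, nsmul_eq_mul]
  have hsort : ∀ᵐ ω ∂P, ω ∈ E (Tuple.sort fun i => Z i ω) := by
    filter_upwards [hinj] with ω hω
    exact (Tuple.monotone_sort _).strictMono_of_injective (hω.comp (Equiv.injective _))
  have hcov : (⋃ σ ∈ Finset.univ, E σ) =ᵐ[P] (Set.univ : Set Ω) := by
    filter_upwards [hsort] with ω hω
    refine propext ⟨fun _ => trivial, fun _ => ?_⟩
    exact Set.mem_biUnion (Finset.mem_coe.2 (Finset.mem_univ _)) hω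
  -- The N! disjoint, equiprobable ordering events cover almost everything, so each has probability
  -- 1/N!.
  have htot := hfin Finset.univ
  rw [measureReal_congr hcov, probReal_univ, Finset.card_univ, Fintype.card_perm,
    Fintype.card_fin] at htot
  -- Up to a null set the event is a finite union of ordering events, so Q itself need not be
  -- measurable.
  have hQE : {ω | Q fun i => Z i ω} =ᵐ[P] (⋃ σ ∈ Finset.univ.filter q, E σ) := by
    filter_upwards [hsort] with ω hω
    refine propext ⟨fun h => ?_, fun h => ?_⟩
    · refine Set.mem_biUnion (Finset.mem_coe.2 (Finset.mem_filter.2 ⟨Finset.mem_univ _, ?_⟩)) hω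
      exact (hQ _ _ hω).1 h
    · obtain ⟨σ, hσ, hσE⟩ := Set.mem_iUnion₂.1 h
      exact (hQ _ σ hσE).2 (Finset.mem_filter.1 hσ).2
  have hN : (N.factorial : ℝ) ≠ 0 := by exact_mod_cast N.factorial_ne_zero
  rw [measureReal_congr hQE, hfin, eq_div_iff hN, mul_assoc, mul_comm (P.real (E 1)), ← htot,
    mul_one]

/-! ### The joint law of R and D, and the law of T. -/

open Classical in
/-- The joint law of the statistics `R` and `D`, evaluated on an arbitrary event. -/
theorem measureReal_statR_statD {Ω : Type*} [MeasurableSpace Ω] (P : Measure Ω)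
    [IsProbabilityMeasure P] (n m p : ℕ) (hn : 0 < n) (hp : 0 < p) (hm : m = n * p)
    (X : Fin n → Ω → ℝ) (Y : Fin m → Ω → ℝ)
    (hXmeas : ∀ i, Measurable (X i)) (hYmeas : ∀ i, Measurable (Y i))
    (hindep : iIndepFun (Sum.elim X Y) P) (F : ℝ → ℝ)
    (hX : ∀ i t, P.real {ω | X i ω ≤ t} = F t) (hY : ∀ i t, P.real {ω | Y i ω ≤ t} = F t)
    (hF : Continuous F) (Q : ℕ → ℝ → Prop) :
    P.real {ω | Q (statR (fun i => X i ω) (fun i => Y i ω))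
        (statD (fun i => X i ω) (fun i => Y i ω))} =
      ∑ r ∈ Finset.Icc 1 (n + m), ∑ k ∈ Finset.range (m + 1),
        if Q r ((k : ℝ) / (m : ℝ)) then gutjahrProb n m r k else 0 := by
  let μ : Measure ℝ := P.map (X ⟨0, hn⟩)
  have hμp : IsProbabilityMeasure μ := Measure.isProbabilityMeasure_map (hXmeas _).aemeasurable
  have hμF : ∀ t, μ.real (Set.Iic t) = F t := fun t => by
    rw [map_measureReal_apply (hXmeas _) measurableSet_Iic]
    exact hX _ t
  have := nullSingletonClass_of_continuous_cdf μ hF hμF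
  have hlaw : ∀ f : Ω → ℝ, Measurable f → (∀ t, P.real {ω | f ω ≤ t} = F t) → P.map f = μ := by
    intro f hf hfF
    have := Measure.isProbabilityMeasure_map (μ := P) hf.aemeasurable
    refine Measure.ext_of_Iic _ _ fun t => ?_
    rw [← ENNReal.toReal_eq_toReal_iff' (measure_ne_top _ _) (measure_ne_top _ _)]
    change (P.map f).real _ = μ.real _
    rw [hμF, map_measureReal_apply hf measurableSet_Iic]
    exact hfF t
  let Z : Fin (n + m) → Ω → ℝ := fun i => Sum.elim X Y (finSumFinEquiv.symm i)
  have hZ : ∀ i, Measurable (Z i) := fun i => by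
    rcases h : finSumFinEquiv.symm i with j | j <;> simp only [Z, h, Sum.elim_inl, Sum.elim_inr]
    exacts [hXmeas j, hYmeas j]
  have hZμ : ∀ i, P.map (Z i) = μ := fun i => by
    rcases h : finSumFinEquiv.symm i with j | j <;> simp only [Z, h, Sum.elim_inl, Sum.elim_inr]
    exacts [hlaw _ (hXmeas j) (hX j), hlaw _ (hYmeas j) (hY j)]
  have hind : iIndepFun Z P := hindep.precomp finSumFinEquiv.symm.injective
  let q : Equiv.Perm (Fin (n + m)) → Prop := fun σ => ∃ r k : ℕ, (1 ≤ r ∧ r ≤ n + m) ∧ k ≤ m ∧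
    IsFirstMax p (permWord n σ) r k ∧ Q r ((k : ℝ) / (m : ℝ))
  have hstat : ∀ (x : Fin n → ℝ) (y : Fin m → ℝ) (σ : Equiv.Perm (Fin (n + m))),
      StrictMono (Fin.append x y ∘ σ) → (Q (statR x y) (statD x y) ↔ q σ) := by
    intro x y σ hσ
    constructor
    · intro h
      obtain ⟨r, k, hr, hk, hmax⟩ : ∃ r k : ℕ, (1 ≤ r ∧ r ≤ n + m) ∧ k ≤ m ∧
          IsFirstMax p (permWord n σ) r k := by
        subst hm
        exact exists_isFirstMax hn σ
      rw [statR_eq_of_isFirstMax hn hp hm hσ hr.1 hr.2 hmax,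
        statD_eq_of_isFirstMax hn hp hm hσ hr.1 hr.2 hmax, Int.cast_natCast] at h
      exact ⟨r, k, hr, hk, hmax, h⟩
    · rintro ⟨r, k, hr, hk, hmax, h⟩
      rwa [statR_eq_of_isFirstMax hn hp hm hσ hr.1 hr.2 hmax,
        statD_eq_of_isFirstMax hn hp hm hσ hr.1 hr.2 hmax, Int.cast_natCast]
  have key := measureReal_eq_card_div P μ Z hZ hind hZμ
    (fun z => Q (statR (fun i => z (Fin.castAdd m i)) fun i => z (Fin.natAdd n i))
      (statD (fun i => z (Fin.castAdd m i)) fun i => z (Fin.natAdd n i))) q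
    (fun z σ hσ => hstat _ _ σ (by rwa [Fin.append_castAdd_natAdd]))
  simp only [Z, finSumFinEquiv_symm_apply_castAdd, finSumFinEquiv_symm_apply_natAdd, Sum.elim_inl,
    Sum.elim_inr] at key
  rw [key]
  -- Split the orderings by the location and height of the first maximum; `IsFirstMax.unique` makes
  -- the pieces disjoint.
  have hset : Finset.univ.filter q = ((Finset.Icc 1 (n + m) ×ˢ Finset.range (m + 1)).filter
      fun a => Q a.1 ((a.2 : ℝ) / (m : ℝ))).biUnion fun a =>
        Finset.univ.filter fun σ => IsFirstMax p (permWord n σ) a.1 a.2 := by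
    ext σ
    simp only [Finset.mem_filter, Finset.mem_univ, true_and, Finset.mem_biUnion,
      Finset.mem_product, Finset.mem_Icc, Finset.mem_range, Prod.exists, q]
    refine exists_congr fun r => exists_congr fun k => ?_
    rw [Nat.lt_succ_iff]
    tauto
  rw [hset, Finset.card_biUnion]
  · rw [Finset.sum_filter, Finset.sum_product, Nat.cast_sum, Finset.sum_div]
    refine Finset.sum_congr rfl fun r hr => ?_
    rw [Nat.cast_sum, Finset.sum_div]
    refine Finset.sum_congr rfl fun k _ => ?_
    rw [Finset.mem_Icc] at hr
    split_ifs
    · subst hm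
      exact card_isFirstMax_div n p hn hp hr.1 hr.2
    · simp
  · rintro ⟨r, k⟩ h1 ⟨r', k'⟩ h2 hne
    refine Finset.disjoint_left.2 fun σ hσ hσ' => hne ?_
    simp only [Finset.mem_coe, Finset.mem_filter, Finset.mem_product, Finset.mem_Icc, Finset.mem_univ,
      true_and] at h1 h2 hσ hσ'
    obtain ⟨e1, e2⟩ := hσ.unique h1.1.1.1 h1.1.1.2 h2.1.1.1 h2.1.1.2 hσ'
    rw [e1, Int.natCast_inj.1 e2]

theorem theorem1 {Ω : Type*} [MeasurableSpace Ω] (P : Measure Ω) [IsProbabilityMeasure P]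
    (n m p : ℕ) (hn : 0 < n) (hp : 0 < p) (hm : m = n * p)
    (X : Fin n → Ω → ℝ) (Y : Fin m → Ω → ℝ)
    (hXmeas : ∀ i, Measurable (X i)) (hYmeas : ∀ i, Measurable (Y i))
    (hindep : iIndepFun (Sum.elim X Y) P)
    (F G : ℝ → ℝ)
    (hX : ∀ i t, P.real {ω | X i ω ≤ t} = F t)
    (hY : ∀ i t, P.real {ω | Y i ω ≤ t} = G t)
    (hF : Continuous F) (hG : Continuous G) (hFG : F = G) :
    (∀ r k : ℕ, 1 ≤ r → r ≤ n + m → k ≤ m →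
      P.real {ω | statR (fun i => X i ω) (fun i => Y i ω) = r ∧
        statD (fun i => X i ω) (fun i => Y i ω) = (k : ℝ) / (m : ℝ)} = gutjahrProb n m r k) ∧
    (∀ x : ℝ, 0 ≤ x →
      P.real {ω | statT (fun i => X i ω) (fun i => Y i ω) ≤ x} =
        (∑ r ∈ Finset.Icc 1 (n + m - 1),
          ∑ k ∈ Finset.range
              (min ⌊(m : ℝ) * Real.sqrt ((r : ℝ) * ((n : ℝ) + (m : ℝ) - (r : ℝ))) * x⌋₊ m + 1),
            gutjahrProb n m r k)
          + (m : ℝ) / (((n : ℝ) + (m : ℝ)) * ((n : ℝ) + (m : ℝ) - 1))) ∧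
    (∀ x : ℝ, x < 0 →
      P.real {ω | statT (fun i => X i ω) (fun i => Y i ω) ≤ x} = 0) := by
  classical
  subst hFG
  have key := measureReal_statR_statD P n m p hn hp hm X Y hXmeas hYmeas hindep F hX hY hF
  have hm0 : 0 < m := hm ▸ Nat.mul_pos hn hp
  have hmR : (0 : ℝ) < m := by exact_mod_cast hm0
  let T : ℕ → ℝ → ℝ := fun r d =>
    if r = n + m then 0 else d / Real.sqrt ((r : ℝ) * ((n : ℝ) + (m : ℝ) - (r : ℝ)))
  have hT0 : ∀ r k : ℕ, 0 ≤ T r ((k : ℝ) / m) := by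
    intro r k
    simp only [T]
    split_ifs <;> positivity
  refine ⟨fun r k hr hrN hk => ?_, fun x hx => ?_, fun x hx => ?_⟩
  · rw [key fun r' d => r' = r ∧ d = (k : ℝ) / m,
      Finset.sum_eq_single_of_mem r (Finset.mem_Icc.2 ⟨hr, hrN⟩),
      Finset.sum_eq_single_of_mem k (Finset.mem_range.2 (by omega))]
    · simp
    · intro k' _ hne
      rw [if_neg]
      rintro ⟨-, h⟩
      exact hne (by exact_mod_cast (div_left_inj' hmR.ne').1 h)
    · intro r' _ hne
      exact Finset.sum_eq_zero fun k' _ => if_neg fun h => hne h.1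
  · have h1 := key fun r d => T r d ≤ x
    change P.real {ω | statT (fun i => X i ω) (fun i => Y i ω) ≤ x} = _ at h1
    have hsplit : ∀ f : ℕ → ℝ, ∑ r ∈ Finset.Icc 1 (n + m), f r =
        ∑ r ∈ Finset.Icc 1 (n + m - 1), f r + f (n + m) := by
      intro f
      obtain ⟨N, hN⟩ : ∃ N, n + m = N + 1 := ⟨n + m - 1, by omega⟩
      rw [hN, Nat.add_sub_cancel, Finset.sum_Icc_succ_top (by omega)]
    rw [h1, hsplit]
    congr 1
    · refine Finset.sum_congr rfl fun r hr => ?_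
      rw [Finset.mem_Icc] at hr
      have hrR : (r : ℝ) < n + m := by exact_mod_cast (by omega : r < n + m)
      have hr0 : (0 : ℝ) < r := by exact_mod_cast hr.1
      have hs : 0 < Real.sqrt ((r : ℝ) * ((n : ℝ) + (m : ℝ) - (r : ℝ))) :=
        Real.sqrt_pos.2 (mul_pos hr0 (by linarith))
      rw [← Finset.sum_filter]
      refine Finset.sum_congr ?_ fun _ _ => rfl
      ext k
      rw [Finset.mem_filter, Finset.mem_range, Finset.mem_range,
        show T r ((k : ℝ) / m) = _ from if_neg (by omega),
        Nat.lt_succ_iff, Nat.lt_succ_iff, le_min_iff, Nat.le_floor_iff (by positivity),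
        div_le_iff₀ hs, div_le_iff₀ hmR, and_comm,
        show x * Real.sqrt ((r : ℝ) * ((n : ℝ) + (m : ℝ) - (r : ℝ))) * m =
          m * Real.sqrt ((r : ℝ) * ((n : ℝ) + (m : ℝ) - (r : ℝ))) * x by ring]
    -- At r = n+m the statistic is 0 ≤ x, so every k is admitted, but only k = 0 has nonzero mass.
    · simp only [show ∀ d, T (n + m) d = 0 from fun d => if_pos rfl, hx, if_true]
      rw [Finset.sum_eq_single_of_mem 0 (Finset.mem_range.2 (by omega))]
      · subst hm
        exact gutjahrProb_last_zero n p hn hp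
      · intro k _ hk
        subst hm
        exact gutjahrProb_last_of_pos n p hn (Nat.pos_of_ne_zero hk)
  · have h1 := key fun r d => T r d ≤ x
    change P.real {ω | statT (fun i => X i ω) (fun i => Y i ω) ≤ x} = _ at h1
    rw [h1]
    exact Finset.sum_eq_zero fun r _ => Finset.sum_eq_zero fun k _ =>
      if_neg fun h => absurd (hT0 r k) (not_le.2 (h.trans_lt hx))
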